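/- Let $\lambda>0$ and let $\mathbb{Z}^2_{even}=\{(i,j)\in\mathbb{Z}^2: i+j \text{ is even}\}$. Let $(\xi^s_{i,j})_{s\in[0,\infty)}$, $(i,j)\in\mathbb{Z}^2_{even}$, be independent càdlàg continuous-time Markov processes with state space $\{-1,+1\}$, each changing state at rate $\lambda/2$ in either direction, with $\mathbb{P}(\xi^0_{i,j}=+1)=\mathbb{P}(\xi^0_{i,j}=-1)=\tfrac12$. For each dynamical time $s\ge 0$ and each $(i,j)\in\mathbb{Z}^2_{even}$ let $S^s_{(i,j)}$ be the path of the dynamical discrete web that starts at location $i$ at time $j$ and follows the arrows at dynamical time $s$: $S^s_{(i,j)}(j)=i$ and $S^s_{(i,j)}(t+1)=S^s_{(i,j)}(t)+\xi^s_{S^s_{(i,j)}(t),\,t}$ for all integers $t\ge j$. Then, almost surely, for all $s\in[0,\infty)$ simultaneously, every path of the web is recurrent: for every $(i,j)\in\mathbb{Z}^2_{even}$ and every $x\in\mathbb{Z}$, there are infinitely many integers $t\ge j$ with $S^s_{(i,j)}(t)=x$. -/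

import Mathlib

open MeasureTheory ProbabilityTheory Filter Topology
open scoped NNReal

namespace DynamicalDiscreteWeb

/-- The even space-time sublattice of `ℤ²`: points `(i, j)` (location `i`, walk time `j`) with
`i + j` even. -/
abbrev EvenLattice : Type := {z : ℤ × ℤ // Even (z.1 + z.2)}

/-- A static arrow configuration: a sign in `{-1, +1} = ℤˣ` at each point of the even lattice. -/
abbrev Arrows : Type := EvenLattice → ℤˣ

/-- Following the arrow out of `(i, j)`: it points to `(i + η (i, j), j + 1)`. -/
def step (η : Arrows) (z : EvenLattice) : EvenLattice :=
  ⟨(z.1.1 + (η z : ℤ), z.1.2 + 1), by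
    obtain ⟨k, hk⟩ := z.2
    rcases Int.units_eq_one_or (η z) with h | h
    · exact ⟨k + 1, by rw [h]; push_cast; omega⟩
    · exact ⟨k, by rw [h]; push_cast; omega⟩⟩

/-- The location, after `n` steps (that is, at walk time `j + n`), of the path that starts at
`z = (i, j)` and follows the arrows of `η`. -/
def path (η : Arrows) (z : EvenLattice) (n : ℕ) : ℤ := ((step η)^[n] z).1.1

/-- A path on `ℤ` is recurrent if it visits every site infinitely often. -/
def IsRecurrent (S : ℕ → ℤ) : Prop := ∀ x : ℤ, ∃ᶠ n in atTop, S n = x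

/-- Right-continuous with left limits, for a `{-1, +1}`-valued function on `[0, ∞)`. -/
def IsCadlag (f : ℝ≥0 → ℤˣ) : Prop :=
  ∀ s : ℝ≥0, ContinuousWithinAt f (Set.Ici s) s ∧ ∃ l : ℤˣ, Tendsto f (𝓝[<] s) (𝓝 l)

/-- Transition probabilities of the continuous-time Markov chain on `{-1, +1}` that changes state
at rate `lam / 2` in either direction. -/
noncomputable def transition (lam t : ℝ) (x y : ℤˣ) : ℝ :=
  if x = y then (1 + Real.exp (-(lam * t))) / 2 else (1 - Real.exp (-(lam * t))) / 2

/-- The transition probabilities start from the identity. -/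
theorem transition_zero (lam : ℝ) (x y : ℤˣ) :
    transition lam 0 x y = if x = y then 1 else 0 := by
  unfold transition
  split_ifs <;> norm_num

/-- Kolmogorov's backward equation for the generator with both rates equal to `lam / 2`. -/
theorem hasDerivAt_transition (lam t : ℝ) (x y : ℤˣ) :
    HasDerivAt (fun t => transition lam t x y)
      (lam / 2 * (transition lam t (-x) y - transition lam t x y)) t := by
  have h : HasDerivAt (fun t : ℝ => Real.exp (-(lam * t)))
      (Real.exp (-(lam * t)) * -(lam * 1)) t :=
    (((hasDerivAt_id t).const_mul lam).neg).exp
  by_cases hxy : x = y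
  · have hne : -x ≠ y := by
      subst hxy; rcases Int.units_eq_one_or x with h | h <;> rw [h] <;> decide
    simp only [transition, hxy, if_true]
    rw [if_neg (by rw [← hxy] at hne ⊢; exact hne)]
    exact ((h.const_add 1).div_const 2).congr_deriv (by ring)
  · have he : -x = y := by
      rcases Int.units_eq_one_or x with h | h <;> rcases Int.units_eq_one_or y with h' | h' <;>
        rw [h, h'] at hxy ⊢ <;> simp_all
    simp only [transition, if_neg hxy, if_pos he]
    exact ((h.const_sub 1).div_const 2).congr_deriv (by ring)

/-- `ξ z s` is the arrow at the lattice point `z` at dynamical time `s ∈ [0, ∞)`. The arrows are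
those of the dynamical discrete web with parameter `lam`: the processes `s ↦ ξ z s` are
independent over `z`, and each is a càdlàg Markov process on `{-1, +1}` that changes state at rate
`lam / 2` in either direction and starts from the symmetric Bernoulli law. -/
structure IsDynamicalWeb {Ω : Type*} [MeasurableSpace Ω] (P : Measure Ω) (lam : ℝ)
    (ξ : EvenLattice → ℝ≥0 → Ω → ℤˣ) : Prop where
  measurable : ∀ z s, Measurable (ξ z s)
  cadlag : ∀ z, ∀ᵐ ω ∂P, IsCadlag (fun s => ξ z s ω)
  /-- The Markov property with the given transition probabilities and uniform initial law, as
  the finite-dimensional distributions at times `0 = s 0 ≤ s 1 ≤ … ≤ s n`. -/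
  markov : ∀ (z : EvenLattice) (n : ℕ) (s : Fin (n + 1) → ℝ≥0) (x : Fin (n + 1) → ℤˣ),
    Monotone s → s 0 = 0 →
      P {ω | ∀ k, ξ z (s k) ω = x k} = ENNReal.ofReal
        (1 / 2 * ∏ k : Fin n,
          transition lam ((s k.succ : ℝ) - (s k.castSucc : ℝ)) (x k.castSucc) (x k.succ))
  indep : iIndepFun (fun (z : EvenLattice) (ω : Ω) (s : ℝ≥0) => ξ z s ω) P

end DynamicalDiscreteWeb

namespace DynamicalDiscreteWeb

open scoped ENNReal

/-! It suffices that, almost surely, for all `s` at once every path hits every level: applying this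
to the positions reached later gives recurrence. By reflection the target `x` may be taken above the
start.

Cut dynamical time `[0, T)` into dyadic intervals of length `2 ^ (-m)`. On each, keep only the
arrows that point up throughout the interval. Paths do not cross, so the lowest path built this way
bounds from below every path at a time of the interval. Its arrows are independent over sites and
point up with probability at least `q = 1/2 - lam / 2 ^ m / 4`. By gambler's ruin it climbs `d`
levels with probability at least `(q / (1 - q)) ^ d`. The lowest paths of different intervals are
dependent but all increasing in the arrows, so Harris' inequality bounds the probability that all of
them succeed below by the product, at least `exp (-2 lam D)` with `D` the sum of depths divided by
`2 ^ m` (`exp_le_measure_hits`).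

Freeze each lowest path at `x`. After `n` steps its mean depth has grown by at most `(1 - 2 q) n`,
which stays bounded if `m` is chosen with `2 ^ m` at least of order `n`. Fatou then gives a finite
`C` with `D ≤ C` for infinitely many `n`, so the conditional probability of `lowHits` given `n`
steps does not tend to `0` (`exp_le_condExp`). By Lévy's zero-one law `lowHits` occurs almost surely
(`ae_lowHits`). -/

instance : DiscreteMeasurableSpace ℤˣ := by
  have : MeasurableSingletonClass ℤˣ := ⟨fun x => ⟨{(x : ℤ)}, MeasurableSet.of_discrete, by
    ext y; simp [Units.ext_iff]⟩⟩
  infer_instance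

/-! ### Paths frozen at a level, and their monotonicity. -/

/-- The endpoint of the arrow out of `z` pointing up. -/
def up (z : EvenLattice) : EvenLattice := step (fun _ => 1) z

/-- The endpoint of the arrow out of `z` pointing down. -/
def down (z : EvenLattice) : EvenLattice := step (fun _ => -1) z

@[simp] lemma up_fst (z : EvenLattice) : (up z).1.1 = z.1.1 + 1 := rfl
@[simp] lemma up_snd (z : EvenLattice) : (up z).1.2 = z.1.2 + 1 := rfl
@[simp] lemma down_fst (z : EvenLattice) : (down z).1.1 = z.1.1 - 1 := rfl
@[simp] lemma down_snd (z : EvenLattice) : (down z).1.2 = z.1.2 + 1 := rfl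

lemma step_eq (η : Arrows) (z : EvenLattice) : step η z = if η z = 1 then up z else down z := by
  rcases Int.units_eq_one_or (η z) with h | h <;> simp [step, up, down, h]

/-- One step of the path, frozen once it has reached `x` from below. -/
def stoppedStep (x : ℤ) (η : Arrows) (z : EvenLattice) : EvenLattice :=
  if x ≤ z.1.1 then z else step η z

/-- The state after `n` steps of the path from `z` frozen on reaching `x` from below. -/
def stopped (x : ℤ) (η : Arrows) (n : ℕ) (z : EvenLattice) : EvenLattice :=
  (stoppedStep x η)^[n] z

/-- The path from `z` reaches `x` from below within `n` steps. -/
def Hits (x : ℤ) (η : Arrows) (n : ℕ) (z : EvenLattice) : Prop := x ≤ (stopped x η n z).1.1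

/-- The distance of `z` from level `x` when `z` lies below this level. -/
def depth (x : ℤ) (z : EvenLattice) : ℕ := (x - z.1.1).toNat

@[simp] lemma stopped_zero (x : ℤ) (η : Arrows) (z : EvenLattice) : stopped x η 0 z = z := rfl

lemma stopped_of_le {x : ℤ} (η : Arrows) (n : ℕ) {z : EvenLattice} (h : x ≤ z.1.1) :
    stopped x η n z = z :=
  Function.iterate_fixed (by simp [stoppedStep, h]) n

lemma stopped_succ {x : ℤ} (η : Arrows) (n : ℕ) {z : EvenLattice} (h : z.1.1 < x) :
    stopped x η (n + 1) z = stopped x η n (if η z = 1 then up z else down z) := by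
  rw [stopped, Function.iterate_succ_apply, stoppedStep, if_neg (not_le.2 h), step_eq]; rfl

lemma stopped_add (x : ℤ) (η : Arrows) (m n : ℕ) (z : EvenLattice) :
    stopped x η (m + n) z = stopped x η n (stopped x η m z) := by
  rw [stopped, add_comm, Function.iterate_add_apply]; rfl

lemma Hits.exists_path_eq {x : ℤ} {η : Arrows} {n : ℕ} {z : EvenLattice} (h : Hits x η n z)
    (hz : z.1.1 ≤ x) : ∃ m, path η z m = x := by
  induction n generalizing z with
  | zero => exact ⟨0, le_antisymm hz h⟩
  | succ n ih =>
    rcases hz.eq_or_lt with hz | hz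
    · exact ⟨0, hz⟩
    · rw [Hits, stopped_succ _ _ hz] at h
      obtain ⟨m, hm⟩ := ih h (by split_ifs <;> simp <;> omega)
      refine ⟨m + 1, ?_⟩
      rw [path, Function.iterate_succ_apply, step_eq]
      exact hm

/-- Paths do not cross: raising the arrows and the starting point keeps a hit. -/
lemma Hits.of_le {x : ℤ} {η η' : Arrows} (hη : η ≤ η') {n : ℕ} {z z' : EvenLattice}
    (h2 : z.1.2 = z'.1.2) (h1 : z.1.1 ≤ z'.1.1) (h : Hits x η n z) : Hits x η' n z' := by
  induction n generalizing z z' with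
  | zero => exact le_trans (α := ℤ) h h1
  | succ n ih =>
    by_cases hz' : x ≤ z'.1.1
    · rw [Hits, stopped_of_le _ _ hz']; exact hz'
    · push Not at hz'
      have hz : z.1.1 < x := h1.trans_lt hz'
      rw [Hits, stopped_succ _ _ hz']
      rw [Hits, stopped_succ _ _ hz] at h
      refine ih ?_ ?_ h
      · split_ifs <;> simpa
      · have := z.2
        have := z'.2
        rcases h1.eq_or_lt with h1 | h1
        · have : z = z' := Subtype.ext (Prod.ext h1 h2)
          subst this
          by_cases h3 : η z = 1
          · have h4 : η' z = 1 := by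
              have := hη z
              rw [h3] at this
              rcases Int.units_eq_one_or (η' z) with h | h
              · exact h
              · rw [h] at this; exact absurd (show (1 : ℤˣ) ≤ -1 from this) (by decide)
            rw [if_pos h3, if_pos h4]
          · rw [if_neg h3]; split_ifs <;> (simp; try omega)
        -- By parity, distinct starting points at the same walk time are at least two apart, so one
        -- step cannot reverse their order.
        · obtain ⟨a, ha⟩ := z.2
          obtain ⟨b, hb⟩ := z'.2
          split_ifs <;> simp <;> omega

/-- The stopped path depends on finitely many arrows. -/
lemma exists_finset_stopped_congr (x : ℤ) (n : ℕ) (z : EvenLattice) :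
    ∃ V : Finset EvenLattice, ∀ η η' : Arrows, (∀ v ∈ V, η v = η' v) →
      stopped x η n z = stopped x η' n z := by
  classical
  induction n generalizing z with
  | zero => exact ⟨∅, fun _ _ _ => rfl⟩
  | succ n ih =>
    by_cases hz : x ≤ z.1.1
    · exact ⟨∅, fun _ _ _ => by rw [stopped_of_le _ _ hz, stopped_of_le _ _ hz]⟩
    push Not at hz
    obtain ⟨V, hV⟩ := ih (up z)
    obtain ⟨W, hW⟩ := ih (down z)
    refine ⟨insert z (V ∪ W), fun η η' h => ?_⟩
    rw [stopped_succ _ _ hz, stopped_succ _ _ hz, h z (by simp)]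
    split_ifs
    · exact hV _ _ fun v hv => h v (by simp [hv])
    · exact hW _ _ fun v hv => h v (by simp [hv])

/-- An unfrozen path has used up all `n` units of walk time, so its continuation reads only arrows
independent of its past. -/
lemma stopped_snd_eq {x : ℤ} {η : Arrows} {n : ℕ} {z : EvenLattice} (h : ¬ Hits x η n z) :
    (stopped x η n z).1.2 = z.1.2 + n := by
  induction n generalizing z with
  | zero => simp
  | succ n ih =>
    by_cases hz : x ≤ z.1.1
    · rw [Hits, stopped_of_le _ _ hz] at h; exact absurd hz h
    · rw [Hits, stopped_succ _ _ (not_le.1 hz)] at h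
      rw [stopped_succ _ _ (not_le.1 hz), ih h]
      split_ifs <;> simp <;> omega

section Measurability

variable {Ω : Type*} {m : MeasurableSpace Ω} {ζ : EvenLattice → Ω → ℤˣ}

/-- The sigma-algebra is arbitrary and only a strip of walk times is constrained, so that this
serves both for the past and for the future of a path. -/
lemma measurable_stopped (x : ℤ) (n : ℕ) (z : EvenLattice)
    (h : ∀ v : EvenLattice, z.1.2 ≤ v.1.2 → v.1.2 < z.1.2 + n → Measurable (ζ v)) :
    Measurable fun ω => stopped x (fun v => ζ v ω) n z := by
  induction n generalizing z with
  | zero => exact measurable_const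
  | succ n ih =>
    by_cases hz : x ≤ z.1.1
    · simp_rw [stopped_of_le _ _ hz]; exact measurable_const
    · push Not at hz
      have e : (fun ω => stopped x (fun v => ζ v ω) (n + 1) z) = fun ω =>
          if ζ z ω = 1 then stopped x (fun v => ζ v ω) n (up z)
          else stopped x (fun v => ζ v ω) n (down z) := by
        funext ω
        rw [stopped_succ _ _ hz]
        split_ifs <;> rfl
      rw [e]
      refine Measurable.ite (h z le_rfl (by push_cast; omega) (measurableSet_singleton 1))
        (ih _ fun v h1 h2 => h v ?_ ?_) (ih _ fun v h1 h2 => h v ?_ ?_) <;>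
      simp only [up_snd, down_snd] at h1 h2 <;> push_cast <;> omega

lemma measurableSet_hits (x : ℤ) (n : ℕ) (z : EvenLattice)
    (h : ∀ v : EvenLattice, z.1.2 ≤ v.1.2 → v.1.2 < z.1.2 + n → Measurable (ζ v)) :
    MeasurableSet {ω | Hits x (fun v => ζ v ω) n z} :=
  measurable_stopped x n z h (MeasurableSet.of_discrete (s := {v : EvenLattice | x ≤ v.1.1}))

end Measurability

/-! ### Independent arrows with up-probability at least `q`: gambler's ruin and drift. -/

section Static

variable {Ω : Type*} [MeasurableSpace Ω] {P : Measure Ω} [IsProbabilityMeasure P]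
  {ζ : EvenLattice → Ω → ℤˣ}

lemma measure_eq_one_add_measure_eq_neg_one {Y : Ω → ℤˣ} (hY : Measurable Y) :
    P {ω | Y ω = 1} + P {ω | Y ω = -1} = 1 := by
  rw [← prob_add_prob_compl (μ := P) (hY (measurableSet_singleton 1))]
  congr 2
  ext ω
  rcases Int.units_eq_one_or (Y ω) with h | h <;> simp [h]

omit [IsProbabilityMeasure P] in
-- First-step decomposition: after leaving `z` the path reads only arrows at strictly later walk
-- times, which are independent of the arrow at `z`.
lemma lintegral_stopped_succ (hm : ∀ z, Measurable (ζ z)) (hi : iIndepFun ζ P) {x : ℤ} (n : ℕ)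
    {z : EvenLattice} (hz : z.1.1 < x) (f : EvenLattice → ℝ≥0∞) :
    ∫⁻ ω, f (stopped x (fun v => ζ v ω) (n + 1) z) ∂P =
      P {ω | ζ z ω = 1} * ∫⁻ ω, f (stopped x (fun v => ζ v ω) n (up z)) ∂P +
      P {ω | ζ z ω = -1} * ∫⁻ ω, f (stopped x (fun v => ζ v ω) n (down z)) ∂P := by
  have key : ∀ (e : ℤˣ) (w : EvenLattice), w.1.2 = z.1.2 + 1 →
      ∫⁻ ω, {ω | ζ z ω = e}.indicator 1 ω * f (stopped x (fun v => ζ v ω) n w) ∂P =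
      P {ω | ζ z ω = e} * ∫⁻ ω, f (stopped x (fun v => ζ v ω) n w) ∂P := by
    intro e w hw
    have hle : ∀ v, MeasurableSpace.comap (ζ v) inferInstance ≤ ‹MeasurableSpace Ω› :=
      fun v => (hm v).comap_le
    have hind := indep_iSup_of_disjoint hle ((iIndepFun_iff_iIndep _ _ _).1 hi)
      (S := {z}) (T := {v | z.1.2 < v.1.2}) (by simp)
    have hf : Measurable[⨆ v ∈ ({z} : Set EvenLattice),
        MeasurableSpace.comap (ζ v) inferInstance]
        (Set.indicator (ζ z ⁻¹' {e}) (1 : Ω → ℝ≥0∞)) := by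
      refine Measurable.indicator (@measurable_one _ _ _ (_) _) ?_
      exact Measurable.mono (comap_measurable (ζ z))
        (le_biSup (fun v => MeasurableSpace.comap (ζ v) inferInstance) (Set.mem_singleton z))
        le_rfl (measurableSet_singleton e)
    have hg : Measurable[⨆ v ∈ {v : EvenLattice | z.1.2 < v.1.2},
        MeasurableSpace.comap (ζ v) inferInstance]
        (fun ω => f (stopped x (fun v => ζ v ω) n w)) := by
      refine (measurable_of_countable f).comp (measurable_stopped x n w fun v h1 h2 => ?_)
      have hv : v ∈ {v : EvenLattice | z.1.2 < v.1.2} := by change z.1.2 < v.1.2; omega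
      exact Measurable.mono (comap_measurable (ζ v))
        (le_biSup (fun v => MeasurableSpace.comap (ζ v) inferInstance) hv) le_rfl
    have := lintegral_mul_eq_lintegral_mul_lintegral_of_independent_measurableSpace
      (iSup₂_le fun v _ => hle v) (iSup₂_le fun v _ => hle v) hind hf hg
    rwa [lintegral_indicator_one (hm z (measurableSet_singleton e))] at this
  rw [← key 1 (up z) rfl, ← key (-1) (down z) rfl, ← lintegral_add_left]
  · refine lintegral_congr fun ω => ?_
    rw [stopped_succ _ _ hz]
    rcases Int.units_eq_one_or (ζ z ω) with h | h <;> simp [h, Set.indicator]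
  · refine Measurable.mul (Measurable.indicator measurable_one (hm z (measurableSet_singleton 1)))
      ((measurable_of_countable f).comp (measurable_stopped x n _ fun v _ _ => hm v))

/-- The probability that a walk with up-probability `q` climbs `h` levels within `n` steps. -/
noncomputable def climb (q : ℝ) : ℕ → ℕ → ℝ
  | _, 0 => 1
  | 0, _ + 1 => 0
  | n + 1, h + 1 => q * climb q n h + (1 - q) * climb q n (h + 2)

lemma climb_mem_Icc {q : ℝ} (h0 : 0 ≤ q) (h1 : q ≤ 1) (n h : ℕ) : climb q n h ∈ Set.Icc 0 1 := by
  induction n generalizing h with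
  | zero => cases h <;> simp [climb]
  | succ n ih =>
    cases h with
    | zero => simp [climb]
    | succ h =>
      rw [climb]
      have a := ih h
      have b := ih (h + 2)
      constructor
      · nlinarith [mul_nonneg h0 a.1, mul_nonneg (sub_nonneg.2 h1) b.1]
      · nlinarith [mul_nonneg h0 (sub_nonneg.2 a.2),
          mul_nonneg (sub_nonneg.2 h1) (sub_nonneg.2 b.2)]

lemma climb_succ_le {q : ℝ} (h0 : 0 ≤ q) (h1 : q ≤ 1) (n h : ℕ) :
    climb q n (h + 1) ≤ climb q n h := by
  induction n generalizing h with
  | zero => cases h <;> simp [climb]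
  | succ n ih =>
    cases h with
    | zero => simpa [climb] using (climb_mem_Icc h0 h1 (n + 1) 1).2
    | succ h =>
      rw [climb, climb]
      have h2 : 0 ≤ 1 - q := by linarith
      gcongr
      · exact ih h
      · exact ih _

lemma climb_le_succ {q : ℝ} (h0 : 0 ≤ q) (h1 : q ≤ 1) (n h : ℕ) :
    climb q n h ≤ climb q (n + 1) h := by
  induction n generalizing h with
  | zero =>
    cases h with
    | zero => simp [climb]
    | succ h => simpa [climb] using (climb_mem_Icc h0 h1 1 (h + 1)).1
  | succ n ih =>
    cases h with
    | zero => simp [climb]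
    | succ h =>
      rw [climb, climb]
      have h2 : 0 ≤ 1 - q := by linarith
      gcongr
      · exact ih h
      · exact ih _

/-- Gambler's ruin. -/
lemma exists_climb_tendsto {q : ℝ} (h0 : 0 < q) (h1 : q < 1 / 2) (h : ℕ) :
    ∃ l, Tendsto (fun n => climb q n h) atTop (𝓝 l) ∧ (q / (1 - q)) ^ h ≤ l := by
  have hex : ∀ h, ∃ l, Tendsto (fun n => climb q n h) atTop (𝓝 l) := fun h =>
    ⟨_, tendsto_atTop_ciSup (monotone_nat_of_le_succ fun n => climb_le_succ h0.le (by linarith) n h)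
      ⟨1, by rintro _ ⟨n, rfl⟩; exact (climb_mem_Icc h0.le (by linarith) n h).2⟩⟩
  choose l hl using hex
  refine ⟨l h, hl h, ?_⟩
  have hq : 0 < 1 - q := by linarith
  set r := q / (1 - q) with hr
  have hr0 : 0 < r := div_pos h0 hq
  have hr1 : r < 1 := by rw [hr, div_lt_one hq]; linarith
  have hrq : r * (1 - q) = q := div_mul_cancel₀ _ hq.ne'
  have l0 : l 0 = 1 := tendsto_nhds_unique (hl 0) (by simp [climb])
  have lnn : ∀ h, 0 ≤ l h := fun h => ge_of_tendsto' (hl h) fun n =>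
    (climb_mem_Icc h0.le (by linarith) n h).1
  have lrec : ∀ h, l (h + 1) = q * l h + (1 - q) * l (h + 2) := fun h =>
    tendsto_nhds_unique ((tendsto_add_atTop_iff_nat 1).2 (hl (h + 1)))
      (((hl h).const_mul q).add ((hl (h + 2)).const_mul (1 - q)))
  -- The recursion makes successive differences geometric with ratio `r`. Letting the height tend to
  -- infinity, nonnegativity of `l` then forces `1 - l 1 ≤ 1 - r`.
  have hd : ∀ h, l h - l (h + 1) = r ^ h * (1 - l 1) := by
    intro h
    induction h with
    | zero => simp [l0]
    | succ h ih =>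
      have := lrec h
      have h3 : (1 - q) * (l (h + 1) - l (h + 2)) = (1 - q) * (r ^ (h + 1) * (1 - l 1)) := by
        calc _ = q * (l h - l (h + 1)) := by linarith
          _ = _ := by
            rw [ih, pow_succ]
            linear_combination (-(r ^ h * (1 - l 1))) * hrq
      exact mul_left_cancel₀ hq.ne' h3
  have hs : ∀ h, (1 - r) * (1 - l h) = (1 - r ^ h) * (1 - l 1) := by
    intro h
    induction h with
    | zero => simp [l0]
    | succ h ih =>
      have : 1 - l (h + 1) = (1 - l h) + r ^ h * (1 - l 1) := by linarith [hd h]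
      rw [this, mul_add, ih]; ring
  have hlim : 1 - l 1 ≤ 1 - r := by
    have h3 : Tendsto (fun h : ℕ => (1 - r ^ h) * (1 - l 1)) atTop (𝓝 ((1 - 0) * (1 - l 1))) :=
      ((tendsto_pow_atTop_nhds_zero_of_lt_one hr0.le hr1).const_sub 1).mul_const _
    have := le_of_tendsto' h3 (b := 1 - r) fun h => by
      rw [← hs h]; nlinarith [lnn h]
    linarith
  have h4 : (1 - r) * (1 - l h) ≤ (1 - r) * (1 - r ^ h) := by
    rw [hs h, mul_comm (1 - r)]
    exact mul_le_mul_of_nonneg_left hlim (by linarith [pow_le_one₀ hr0.le hr1.le (n := h)])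
  have := le_of_mul_le_mul_left h4 (by linarith)
  linarith

lemma depth_of_lt {x : ℤ} {z : EvenLattice} (hz : z.1.1 < x) :
    ∃ h, depth x z = h + 1 ∧ depth x (up z) = h ∧ depth x (down z) = h + 2 := by
  refine ⟨depth x (up z), ?_, rfl, ?_⟩ <;> simp only [depth, up_fst, down_fst] <;> omega

lemma depth_of_le {x : ℤ} {z : EvenLattice} (hz : x ≤ z.1.1) : depth x z = 0 := by
  simp only [depth]; omega

lemma ofReal_climb_le_measure_hits (hm : ∀ z, Measurable (ζ z)) (hi : iIndepFun ζ P) {q : ℝ}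
    (h0 : 0 ≤ q) (h1 : q ≤ 1) (hq : ∀ z, ENNReal.ofReal q ≤ P {ω | ζ z ω = 1}) (x : ℤ) (n : ℕ)
    (z : EvenLattice) :
    ENNReal.ofReal (climb q n (depth x z)) ≤ P {ω | Hits x (fun v => ζ v ω) n z} := by
  induction n generalizing z with
  | zero =>
    by_cases hz : x ≤ z.1.1
    · simp [Hits, hz, depth_of_le hz, climb]
    · obtain ⟨h, e, -⟩ := depth_of_lt (not_le.1 hz)
      simp [e, climb]
  | succ n ih =>
    by_cases hz : x ≤ z.1.1
    · simp [Hits, stopped_of_le _ _ hz, hz, depth_of_le hz, climb]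
    push Not at hz
    obtain ⟨h, e, eu, ed⟩ := depth_of_lt hz
    have conv : ∀ n z, P {ω | Hits x (fun v => ζ v ω) n z} =
        ∫⁻ ω, {v : EvenLattice | x ≤ v.1.1}.indicator 1 (stopped x (fun v => ζ v ω) n z) ∂P := by
      intro n z
      rw [← lintegral_indicator_one (measurableSet_hits x n z fun v _ _ => hm v)]
      rfl
    rw [conv, lintegral_stopped_succ hm hi n hz, ← conv, ← conv]
    refine le_trans ?_ (add_le_add (mul_le_mul_right (ih (up z)) _) (mul_le_mul_right (ih (down z)) _))
    have hsum := measure_eq_one_add_measure_eq_neg_one (P := P) (hm z)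
    rw [e, eu, ed, climb]
    have ha := hq z
    rw [← ENNReal.ofReal_toReal (measure_ne_top P {ω | ζ z ω = 1})] at ha hsum ⊢
    rw [← ENNReal.ofReal_toReal (measure_ne_top P {ω | ζ z ω = -1})] at hsum ⊢
    set a := (P {ω | ζ z ω = 1}).toReal
    set b := (P {ω | ζ z ω = -1}).toReal
    have ha0 : 0 ≤ a := ENNReal.toReal_nonneg
    have hb0 : 0 ≤ b := ENNReal.toReal_nonneg
    rw [← ENNReal.ofReal_add ha0 hb0, ENNReal.ofReal_eq_one] at hsum
    rw [ENNReal.ofReal_le_ofReal_iff ha0] at ha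
    rw [← ENNReal.ofReal_mul ha0, ← ENNReal.ofReal_mul hb0, ← ENNReal.ofReal_add
      (mul_nonneg ha0 (climb_mem_Icc h0 h1 _ _).1) (mul_nonneg hb0 (climb_mem_Icc h0 h1 _ _).1)]
    refine ENNReal.ofReal_le_ofReal ?_
    have h3 : climb q n (h + 2) ≤ climb q n h :=
      (climb_succ_le h0 h1 n (h + 1)).trans (climb_succ_le h0 h1 n h)
    have hb : b = 1 - a := by linarith
    rw [hb]
    -- The difference of the two sides is `(a - q) * (climb q n h - climb q n (h + 2))`: raising the
    -- up-probability only helps.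
    nlinarith [mul_nonneg (sub_nonneg.2 ha) (sub_nonneg.2 h3)]

/-- A live path gains mean depth at most `1 - 2 * q` per step, and a frozen one stays at depth `0`.
-/
lemma lintegral_depth_stopped_le (hm : ∀ z, Measurable (ζ z)) (hi : iIndepFun ζ P) {q : ℝ}
    (h1 : q ≤ 1 / 2) (hq : ∀ z, ENNReal.ofReal q ≤ P {ω | ζ z ω = 1}) (x : ℤ) (n : ℕ)
    (z : EvenLattice) :
    ∫⁻ ω, (depth x (stopped x (fun v => ζ v ω) n z) : ℝ≥0∞) ∂P ≤
      ENNReal.ofReal (depth x z + (1 - 2 * q) * n) := by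
  induction n generalizing z with
  | zero => simp
  | succ n ih =>
    have hc : 0 ≤ (1 - 2 * q) * n := mul_nonneg (by linarith) n.cast_nonneg
    by_cases hz : x ≤ z.1.1
    · simp [stopped_of_le _ _ hz, depth_of_le hz]
    push Not at hz
    obtain ⟨h, e, eu, ed⟩ := depth_of_lt hz
    rw [lintegral_stopped_succ hm hi n hz fun v => (depth x v : ℝ≥0∞)]
    refine (add_le_add (mul_le_mul_right (ih (up z)) _) (mul_le_mul_right (ih (down z)) _)).trans ?_
    have hsum := measure_eq_one_add_measure_eq_neg_one (P := P) (hm z)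
    rw [e, eu, ed]
    have ha := hq z
    rw [← ENNReal.ofReal_toReal (measure_ne_top P {ω | ζ z ω = 1})] at ha hsum ⊢
    rw [← ENNReal.ofReal_toReal (measure_ne_top P {ω | ζ z ω = -1})] at hsum ⊢
    set a := (P {ω | ζ z ω = 1}).toReal
    set b := (P {ω | ζ z ω = -1}).toReal
    have ha0 : 0 ≤ a := ENNReal.toReal_nonneg
    have hb0 : 0 ≤ b := ENNReal.toReal_nonneg
    rw [← ENNReal.ofReal_add ha0 hb0, ENNReal.ofReal_eq_one] at hsum
    rw [ENNReal.ofReal_le_ofReal_iff ha0] at ha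
    rw [← ENNReal.ofReal_mul ha0, ← ENNReal.ofReal_mul hb0,
      ← ENNReal.ofReal_add (by positivity) (by positivity)]
    refine ENNReal.ofReal_le_ofReal ?_
    have hb : b = 1 - a := by linarith
    rw [hb]
    push_cast
    nlinarith

end Static

/-! ### The lowest arrow over a set of dynamical times. -/

section Low

open Classical in
/-- The least value of `f` over the times in `S`. -/
noncomputable def minOn (S : Set ℝ≥0) (f : ℝ≥0 → ℤˣ) : ℤˣ := if ∀ s ∈ S, f s = 1 then 1 else -1

lemma minOn_eq_one {S : Set ℝ≥0} {f : ℝ≥0 → ℤˣ} : minOn S f = 1 ↔ ∀ s ∈ S, f s = 1 := by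
  by_cases h : ∀ s ∈ S, f s = 1 <;> simp [minOn, h]

lemma le_of_eq_one_imp {a b : ℤˣ} (h : a = 1 → b = 1) : a ≤ b := by
  rcases Int.units_eq_one_or a with ha | ha <;> rcases Int.units_eq_one_or b with hb | hb
  · rw [ha, hb]
  · exact absurd (h ha) (by rw [hb]; decide)
  · rw [ha, hb]; decide
  · rw [ha, hb]

lemma eq_one_of_le {a b : ℤˣ} (h : a ≤ b) (ha : a = 1) : b = 1 := by
  rcases Int.units_eq_one_or b with hb | hb
  · exact hb
  · rw [ha, hb] at h; exact absurd h (by decide)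

lemma minOn_anti {S S' : Set ℝ≥0} (h : S ⊆ S') (f : ℝ≥0 → ℤˣ) : minOn S' f ≤ minOn S f :=
  le_of_eq_one_imp fun h1 => minOn_eq_one.2 fun s hs => minOn_eq_one.1 h1 s (h hs)

lemma measurable_minOn {S : Set ℝ≥0} (hS : S.Countable) : Measurable (minOn S) := by
  classical
  refine Measurable.ite ?_ measurable_const measurable_const
  have : {f : ℝ≥0 → ℤˣ | ∀ s ∈ S, f s = 1} = ⋂ s ∈ S, (fun f => f s) ⁻¹' {1} := by
    ext f; simp
  change MeasurableSet {f : ℝ≥0 → ℤˣ | ∀ s ∈ S, f s = 1}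
  rw [this]
  exact MeasurableSet.biInter hS fun s _ => measurable_pi_apply s (measurableSet_singleton 1)

lemma eventually_minOn_eq {S : ℕ → Set ℝ≥0} (hS : Monotone S) (f : ℝ≥0 → ℤˣ) :
    ∀ᶠ l in atTop, minOn (S l) f = minOn (⋃ l, S l) f := by
  by_cases h : ∀ s ∈ ⋃ l, S l, f s = 1
  · exact Eventually.of_forall fun l => (minOn_eq_one.2 fun s hs =>
      h s (Set.mem_iUnion_of_mem l hs)).trans (minOn_eq_one.2 h).symm
  · have h' := h
    push Not at h'
    obtain ⟨s, hs, hf⟩ := h'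
    obtain ⟨l, hl⟩ := Set.mem_iUnion.1 hs
    filter_upwards [eventually_ge_atTop l] with m hm
    rw [minOn, minOn, if_neg h, if_neg fun h2 => hf (h2 s (hS hm hl))]

end Low

/-! ### Log-supermodularity of the two-state chain. -/

section Transition

variable {lam : ℝ}

lemma transition_nonneg (hlam : 0 < lam) {t : ℝ} (ht : 0 ≤ t) (x y : ℤˣ) :
    0 ≤ transition lam t x y := by
  have : Real.exp (-(lam * t)) ≤ 1 := Real.exp_le_one_iff.2 (by nlinarith [mul_nonneg hlam.le ht])
  unfold transition
  split_ifs <;> [positivity; linarith]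

/-- Staying is at least as likely as switching, so the sorted pairs carry the larger product. This
is the lattice condition needed for the FKG inequality. -/
lemma transition_supermodular (t : ℝ) (x y x' y' : ℤˣ) :
    transition lam t x y * transition lam t x' y' ≤
      transition lam t (x ⊓ x') (y ⊓ y') * transition lam t (x ⊔ x') (y ⊔ y') := by
  have h := Real.exp_pos (-(lam * t))
  have e1 : (1 : ℤˣ) ⊓ -1 = -1 := by decide
  have e2 : (-1 : ℤˣ) ⊓ 1 = -1 := by decide
  have e3 : (1 : ℤˣ) ⊔ -1 = 1 := by decide
  have e4 : (-1 : ℤˣ) ⊔ 1 = 1 := by decide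
  have e5 : (1 : ℤˣ) ≠ -1 := by decide
  have e6 : (-1 : ℤˣ) ≠ 1 := by decide
  rcases Int.units_eq_one_or x with rfl | rfl <;> rcases Int.units_eq_one_or y with rfl | rfl <;>
  rcases Int.units_eq_one_or x' with rfl | rfl <;> rcases Int.units_eq_one_or y' with rfl | rfl <;>
  simp only [e1, e2, e3, e4, inf_idem, sup_idem, transition, if_true, if_neg e5, if_neg e6] <;>
  nlinarith

/-- The law of the two-state chain at `M + 1` equally spaced times. -/
noncomputable def chainWeight (lam t : ℝ) {M : ℕ} (x : Fin (M + 1) → ℤˣ) : ℝ :=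
  1 / 2 * ∏ k : Fin M, transition lam t (x k.castSucc) (x k.succ)

lemma chainWeight_nonneg (hlam : 0 < lam) {t : ℝ} (ht : 0 ≤ t) {M : ℕ} (x : Fin (M + 1) → ℤˣ) :
    0 ≤ chainWeight lam t x :=
  mul_nonneg (by norm_num) (Finset.prod_nonneg fun _ _ => transition_nonneg hlam ht _ _)

lemma chainWeight_supermodular (hlam : 0 < lam) {t : ℝ} (ht : 0 ≤ t) {M : ℕ}
    (x y : Fin (M + 1) → ℤˣ) :
    chainWeight lam t x * chainWeight lam t y ≤
      chainWeight lam t (x ⊓ y) * chainWeight lam t (x ⊔ y) := by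
  unfold chainWeight
  rw [mul_mul_mul_comm, mul_mul_mul_comm (1 / 2 : ℝ) _ (1 / 2 : ℝ), ← Finset.prod_mul_distrib,
    ← Finset.prod_mul_distrib]
  refine mul_le_mul_of_nonneg_left (Finset.prod_le_prod (fun _ _ => ?_) fun _ _ => ?_) (by norm_num)
  · exact mul_nonneg (transition_nonneg hlam ht _ _) (transition_nonneg hlam ht _ _)
  · exact transition_supermodular _ _ _ _ _

end Transition

/-! ### Harris' inequality on finite grids, and the law of the lowest arrow. -/

namespace IsDynamicalWeb

variable {Ω : Type*} [MeasurableSpace Ω] {P : Measure Ω} [IsProbabilityMeasure P] {lam : ℝ}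
  {ξ : EvenLattice → ℝ≥0 → Ω → ℤˣ}

omit [IsProbabilityMeasure P] in
lemma measurable_fun (hξ : IsDynamicalWeb P lam ξ) (z : EvenLattice) :
    Measurable fun (ω : Ω) (s : ℝ≥0) => ξ z s ω :=
  measurable_pi_lambda _ fun s => hξ.measurable z s

omit [IsProbabilityMeasure P] in
lemma measurable_low (hξ : IsDynamicalWeb P lam ξ) {S : Set ℝ≥0} (hS : S.Countable)
    (z : EvenLattice) : Measurable fun ω => minOn S fun s => ξ z s ω :=
  (measurable_minOn hS).comp (hξ.measurable_fun z)

omit [IsProbabilityMeasure P] in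
lemma iIndepFun_low (hξ : IsDynamicalWeb P lam ξ) {S : Set ℝ≥0} (hS : S.Countable) :
    iIndepFun (fun z ω => minOn S fun s => ξ z s ω) P :=
  hξ.indep.comp (fun _ => minOn S) fun _ => measurable_minOn hS

omit [IsProbabilityMeasure P] in
lemma measure_grid (hξ : IsDynamicalWeb P lam ξ) (z : EvenLattice) (Δ : ℝ≥0) {M : ℕ}
    (x : Fin (M + 1) → ℤˣ) :
    P {ω | ∀ k : Fin (M + 1), ξ z (k * Δ) ω = x k} = ENNReal.ofReal (chainWeight lam Δ x) := by
  rw [hξ.markov z M (fun k => k * Δ) x (fun i j h => by dsimp only; gcongr; exact h) (by simp)]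
  unfold chainWeight
  congr 3 with k
  congr 1
  push_cast
  simp
  ring

/-- All arrows of a finite set of lattice points, on a finite grid of dynamical times. -/
def grid (ξ : EvenLattice → ℝ≥0 → Ω → ℤˣ) (Δ : ℝ≥0) (M : ℕ) (V : Finset EvenLattice) (ω : Ω) :
    V → Fin (M + 1) → ℤˣ := fun v k => ξ v (k * Δ) ω

omit [IsProbabilityMeasure P] in
lemma measurable_grid (hξ : IsDynamicalWeb P lam ξ) (Δ : ℝ≥0) (M : ℕ) (V : Finset EvenLattice) :
    Measurable (grid ξ Δ M V) :=
  measurable_pi_lambda _ fun v => measurable_pi_lambda _ fun _ => hξ.measurable v _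

omit [IsProbabilityMeasure P] in
lemma measureReal_grid_singleton (hlam : 0 < lam) (hξ : IsDynamicalWeb P lam ξ) (Δ : ℝ≥0) (M : ℕ)
    (V : Finset EvenLattice) (a : V → Fin (M + 1) → ℤˣ) :
    P.real (grid ξ Δ M V ⁻¹' {a}) = ∏ v, chainWeight lam Δ (a v) := by
  have h := (hξ.indep.precomp (g := fun v : V => (v : EvenLattice))
    Subtype.val_injective).measure_inter_preimage_eq_mul Finset.univ
    (sets := fun v => {f | ∀ k : Fin (M + 1), f (k * Δ) = a v k}) (fun v _ => by
      have : {f : ℝ≥0 → ℤˣ | ∀ k : Fin (M + 1), f (k * Δ) = a v k} =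
          ⋂ k : Fin (M + 1), (fun f => f (k * Δ)) ⁻¹' {a v k} := by ext; simp
      rw [this]
      exact MeasurableSet.iInter fun k => measurable_pi_apply _ (measurableSet_singleton _))
  have e : grid ξ Δ M V ⁻¹' {a} = ⋂ v ∈ (Finset.univ : Finset V),
      (fun (ω : Ω) (s : ℝ≥0) => ξ v s ω) ⁻¹' {f | ∀ k : Fin (M + 1), f (k * Δ) = a v k} := by
    ext ω
    simp [grid, funext_iff]
  rw [measureReal_def, e, h, ENNReal.toReal_prod]
  refine Finset.prod_congr rfl fun v _ => ?_
  change (P {ω | ∀ k : Fin (M + 1), ξ v (k * Δ) ω = a v k}).toReal = _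
  rw [hξ.measure_grid]
  exact ENNReal.toReal_ofReal (chainWeight_nonneg hlam Δ.2 (a v))

open Classical in
/-- Harris' inequality for the arrows on a finite grid. -/
lemma measureReal_mul_le_inter (hlam : 0 < lam) (hξ : IsDynamicalWeb P lam ξ) (Δ : ℝ≥0) (M : ℕ)
    (V : Finset EvenLattice) {A B : Set (V → Fin (M + 1) → ℤˣ)} (hA : IsUpperSet A)
    (hB : IsUpperSet B) :
    P.real (grid ξ Δ M V ⁻¹' A) * P.real (grid ξ Δ M V ⁻¹' B) ≤
      P.real (grid ξ Δ M V ⁻¹' (A ∩ B)) := by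
  set μ : (V → Fin (M + 1) → ℤˣ) → ℝ := fun a => ∏ v, chainWeight lam Δ (a v) with hμ
  have hm := hξ.measurable_grid Δ M V
  have hsum : ∀ C : Set (V → Fin (M + 1) → ℤˣ),
      P.real (grid ξ Δ M V ⁻¹' C) = ∑ a, μ a * C.indicator 1 a := by
    intro C
    have := sum_measureReal_preimage_singleton (μ := P) (f := grid ξ Δ M V)
      (Finset.univ.filter (· ∈ C)) fun a _ => hm (measurableSet_singleton a)
    rw [Finset.coe_filter] at this
    simp only [Finset.mem_univ, true_and] at this
    change _ = P.real (grid ξ Δ M V ⁻¹' C) at this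
    rw [← this, Finset.sum_filter]
    refine Finset.sum_congr rfl fun a _ => ?_
    rw [hξ.measureReal_grid_singleton hlam]
    by_cases h : a ∈ C <;> simp [h, hμ]
  have hone : ∑ a, μ a = 1 := by
    have := hsum Set.univ
    simpa using this.symm
  have hmono : ∀ C : Set (V → Fin (M + 1) → ℤˣ), IsUpperSet C →
      Monotone (C.indicator (1 : (V → Fin (M + 1) → ℤˣ) → ℝ)) := by
    intro C hC a b hab
    by_cases ha : a ∈ C
    · simp [ha, hC hab ha]
    · simp only [ha, not_false_eq_true, Set.indicator_of_notMem]
      exact Set.indicator_nonneg (fun _ _ => zero_le_one) _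
  have := fkg (A.indicator 1) (B.indicator 1) μ
    (fun a => Finset.prod_nonneg fun v _ => chainWeight_nonneg hlam Δ.2 _)
    (fun a => Set.indicator_nonneg (fun _ _ => zero_le_one) _)
    (fun a => Set.indicator_nonneg (fun _ _ => zero_le_one) _) (hmono A hA) (hmono B hB)
    (fun a b => by
      simp only [hμ, ← Finset.prod_mul_distrib]
      refine Finset.prod_le_prod (fun v _ => ?_) fun v _ => ?_
      · exact mul_nonneg (chainWeight_nonneg hlam Δ.2 _) (chainWeight_nonneg hlam Δ.2 _)
      · exact chainWeight_supermodular hlam Δ.2 _ _)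
  rw [hone, one_mul] at this
  rw [hsum, hsum, hsum]
  refine this.trans_eq (Finset.sum_congr rfl fun a _ => ?_)
  rw [Set.inter_indicator_one, Pi.mul_apply]

lemma prod_measureReal_le {κ : Type*} (hlam : 0 < lam) (hξ : IsDynamicalWeb P lam ξ) (Δ : ℝ≥0)
    (M : ℕ) (V : Finset EvenLattice) (K : Finset κ) {A : κ → Set (V → Fin (M + 1) → ℤˣ)}
    (hA : ∀ k, IsUpperSet (A k)) :
    ∏ k ∈ K, P.real (grid ξ Δ M V ⁻¹' A k) ≤ P.real (grid ξ Δ M V ⁻¹' ⋂ k ∈ K, A k) := by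
  classical
  induction K using Finset.induction_on with
  | empty => simp
  | insert k K hk ih =>
    rw [Finset.prod_insert hk, Finset.set_biInter_insert]
    exact (mul_le_mul_of_nonneg_left ih measureReal_nonneg).trans
      (hξ.measureReal_mul_le_inter hlam Δ M V (hA k) (isUpperSet_iInter₂ fun k _ => hA k))

/-- Each hitting event depends on finitely many arrows at grid times and is increasing in them, so
Harris' inequality applies to all of them together. -/
lemma prod_measureReal_hits_le {κ : Type*} (hlam : 0 < lam) (hξ : IsDynamicalWeb P lam ξ) (Δ : ℝ≥0)
    (M : ℕ) (K : Finset κ) (S : κ → Set ℝ≥0)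
    (hS : ∀ k ∈ K, ∀ s ∈ S k, ∃ i : Fin (M + 1), s = i * Δ) (x : ℤ) (n : ℕ) (z : κ → EvenLattice) :
    ∏ k ∈ K, P.real {ω | Hits x (fun v => minOn (S k) fun s => ξ v s ω) n (z k)} ≤
      P.real {ω | ∀ k ∈ K, Hits x (fun v => minOn (S k) fun s => ξ v s ω) n (z k)} := by
  classical
  choose W hW using fun k => exists_finset_stopped_congr x n (z k)
  set V := K.biUnion W
  -- The value `1` outside `V` is immaterial: the paths in question never depend on those arrows.
  let ext (k : κ) (a : V → Fin (M + 1) → ℤˣ) : Arrows := fun v =>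
    if h : v ∈ V then if ∀ i : Fin (M + 1), (i * Δ : ℝ≥0) ∈ S k → a ⟨v, h⟩ i = 1 then 1 else -1
    else 1
  let A (k : κ) : Set (V → Fin (M + 1) → ℤˣ) := {a | Hits x (ext k a) n (z k)}
  have hA : ∀ k, IsUpperSet (A k) := by
    intro k a b hab ha
    refine Hits.of_le (fun v => ?_) rfl le_rfl ha
    by_cases h : v ∈ V
    · simp only [ext, h, dif_pos]
      refine le_of_eq_one_imp fun h1 => ?_
      rw [if_pos]
      intro i hi
      refine eq_one_of_le (hab ⟨v, h⟩ i) ?_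
      by_contra h2
      rw [if_neg fun h3 => h2 (h3 i hi)] at h1
      exact absurd h1 (by decide)
    · simp only [ext, h, dif_neg, not_false_eq_true, le_refl]
  have hpre : ∀ k ∈ K, ∀ ω, Hits x (fun v => minOn (S k) fun s => ξ v s ω) n (z k) ↔
      grid ξ Δ M V ω ∈ A k := by
    intro k hk ω
    simp only [A, Set.mem_ofPred_eq, Hits]
    rw [hW k]
    intro v hv
    have hv' : v ∈ V := Finset.mem_biUnion.2 ⟨k, hk, hv⟩
    simp only [ext, hv', dif_pos, minOn, grid]
    congr 1
    refine propext ⟨fun h i hi => h _ hi, fun h s hs => ?_⟩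
    obtain ⟨i, rfl⟩ := hS k hk s hs
    exact h i hs
  have := hξ.prod_measureReal_le hlam Δ M V K hA
  refine le_of_eq_of_le (Finset.prod_congr rfl fun k hk => ?_) (this.trans_eq ?_)
  · congr 1; ext ω; exact hpre k hk ω
  · congr 1; ext ω
    simp only [Set.mem_preimage, Set.mem_iInter, Set.mem_ofPred_eq]
    exact forall₂_congr fun k hk => (hpre k hk ω).symm

omit [IsProbabilityMeasure P] in
lemma ofReal_le_measure_low (hlam : 0 < lam) (hξ : IsDynamicalWeb P lam ξ) (z : EvenLattice)
    (Δ : ℝ≥0) (a L : ℕ) :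
    ENNReal.ofReal (1 / 2 - lam * (L * Δ) / 4) ≤
      P {ω | minOn {s | ∃ i < L + 1, s = (a + i : ℕ) * Δ} (fun s => ξ z s ω) = 1} := by
  -- The finite-dimensional laws must start at time `0`, so this time is prepended and the state `e`
  -- there is summed out below.
  have hE : ∀ e : ℤˣ, P {ω | ∀ k : Fin (L + 2), ξ z
      ((Fin.cons 0 fun i : Fin (L + 1) => ((a + i : ℕ) : ℝ≥0) * Δ : Fin (L + 2) → ℝ≥0) k) ω =
      (Fin.cons e fun _ => 1 : Fin (L + 2) → ℤˣ) k} = ENNReal.ofReal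
        (1 / 2 * (transition lam (a * Δ) e 1 * ((1 + Real.exp (-(lam * Δ))) / 2) ^ L)) := by
    intro e
    rw [hξ.markov z (L + 1)]
    · congr 2
      rw [Fin.prod_univ_succ]
      congr 1
      · simp
      · rw [Finset.prod_congr rfl (g := fun _ => (1 + Real.exp (-(lam * Δ))) / 2)]
        · rw [Finset.prod_const, Finset.card_univ, Fintype.card_fin]
        · intro k _
          simp only [Fin.castSucc_succ, Fin.cons_succ, transition, if_true]
          congr 4
          push_cast
          simp only [Fin.val_succ, Fin.val_castSucc]
          push_cast
          ring
    · refine Fin.monotone_iff_le_succ.2 fun i => ?_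
      refine Fin.cases ?_ (fun j => ?_) i
      · simp
      · simp only [Fin.castSucc_succ, Fin.cons_succ]
        gcongr
        simp
    · rfl
  have hsub : ∀ e : ℤˣ, {ω | ∀ k : Fin (L + 2), ξ z
      ((Fin.cons 0 fun i : Fin (L + 1) => ((a + i : ℕ) : ℝ≥0) * Δ : Fin (L + 2) → ℝ≥0) k) ω =
      (Fin.cons e fun _ => 1 : Fin (L + 2) → ℤˣ) k} =
      {ω | minOn {s | ∃ i < L + 1, s = (a + i : ℕ) * Δ} (fun s => ξ z s ω) = 1} ∩
      {ω | ξ z 0 ω = e} := by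
    intro e
    ext ω
    simp only [Set.mem_ofPred_eq, Fin.forall_fin_succ (n := L + 1), Fin.cons_zero, Fin.cons_succ,
      Set.mem_inter_iff, minOn_eq_one]
    rw [and_comm]
    refine and_congr_left fun _ => ⟨?_, fun h i => h _ ⟨i, i.2, rfl⟩⟩
    rintro h s ⟨i, hi, rfl⟩
    exact h ⟨i, hi⟩
  set G := {ω | minOn {s | ∃ i < L + 1, s = (a + i : ℕ) * Δ} (fun s => ξ z s ω) = 1}
  have hG : P G = P (G ∩ {ω | ξ z 0 ω = 1}) + P (G ∩ {ω | ξ z 0 ω = -1}) := by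
    rw [← measure_inter_add_sdiff G (hξ.measurable z 0 (measurableSet_singleton 1))]
    congr 2
    ext ω
    rcases Int.units_eq_one_or (ξ z 0 ω) with h | h <;> simp [h]
  have hT : ∀ e, 0 ≤ transition lam (a * Δ) e 1 := fun e =>
    transition_nonneg hlam (by positivity) _ _
  rw [hG, ← hsub, ← hsub, hE, hE, ← ENNReal.ofReal_add
    (mul_nonneg (by norm_num) (mul_nonneg (hT _) (by positivity)))
    (mul_nonneg (by norm_num) (mul_nonneg (hT _) (by positivity)))]
  refine ENNReal.ofReal_le_ofReal ?_
  have hT1 : transition lam (a * Δ) 1 1 + transition lam (a * Δ) (-1) 1 = 1 := by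
    simp only [transition, if_true, if_neg (show (-1 : ℤˣ) ≠ 1 by decide)]; ring
  rw [← mul_add, ← add_mul, hT1, one_mul]
  -- Arithmetic-geometric mean inequality for `1` and `exp (-(lam * Δ))`.
  have h1 : Real.exp (-(lam * Δ / 2)) ≤ (1 + Real.exp (-(lam * Δ))) / 2 := by
    have : Real.exp (-(lam * Δ)) = Real.exp (-(lam * Δ / 2)) ^ 2 := by
      rw [← Real.exp_nat_mul]; congr 1; push_cast; ring
    rw [this]
    nlinarith [sq_nonneg (1 - Real.exp (-(lam * Δ / 2)))]
  have h2 := pow_le_pow_left₀ (Real.exp_pos _).le h1 L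
  rw [← Real.exp_nat_mul] at h2
  have h3 := Real.add_one_le_exp (L * -(lam * Δ / 2))
  linarith

end IsDynamicalWeb

/-! ### Dyadic times and right-continuity. -/

/-- The level `m + l` dyadic times in `[k / 2 ^ m, (k + 1) / 2 ^ m)`. -/
def dyadicPiece (m k l : ℕ) : Set ℝ≥0 :=
  {s | ∃ i < 2 ^ l, s = (k * 2 ^ l + i : ℕ) * ((2 : ℝ≥0) ^ (m + l))⁻¹}

/-- The dyadic times in `[k / 2 ^ m, (k + 1) / 2 ^ m)`. -/
def dyadicTimes (m k : ℕ) : Set ℝ≥0 := ⋃ l, dyadicPiece m k l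

lemma monotone_dyadicPiece (m k : ℕ) : Monotone (dyadicPiece m k) := by
  refine monotone_nat_of_le_succ fun l => ?_
  rintro s ⟨i, hi, rfl⟩
  refine ⟨2 * i, by rw [pow_succ]; omega, ?_⟩
  have : (2 : ℝ≥0) ^ (m + (l + 1)) = 2 ^ (m + l) * 2 := by rw [← pow_succ]; rfl
  rw [this, show k * 2 ^ (l + 1) + 2 * i = (k * 2 ^ l + i) * 2 by ring]
  push_cast
  field_simp

lemma countable_dyadicPiece (m k l : ℕ) : (dyadicPiece m k l).Countable :=
  (Set.countable_range fun i : ℕ => (k * 2 ^ l + i : ℕ) * ((2 : ℝ≥0) ^ (m + l))⁻¹).mono <| by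
    rintro s ⟨i, -, rfl⟩; exact ⟨i, rfl⟩

lemma countable_dyadicTimes (m k : ℕ) : (dyadicTimes m k).Countable :=
  Set.countable_iUnion fun l => countable_dyadicPiece m k l

lemma exists_tendsto_mem_dyadicTimes (m : ℕ) (s : ℝ≥0) :
    ∃ t : ℕ → ℝ≥0, Tendsto t atTop (𝓝[≥] s) ∧
      ∀ᶠ l in atTop, t l ∈ dyadicTimes m ⌊s * 2 ^ m⌋₊ := by
  set k := ⌊s * 2 ^ m⌋₊ with hk
  have hk1 : (k : ℝ≥0) ≤ s * 2 ^ m := Nat.floor_le zero_le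
  have hk2 : s * 2 ^ m < k + 1 := Nat.lt_floor_add_one _
  -- Round `s` up to level `m + l`. As `s` lies strictly before the right end of its interval, the
  -- rounded times eventually stay inside.
  let t : ℕ → ℝ≥0 := fun l => ⌈s * 2 ^ (m + l)⌉₊ * ((2 : ℝ≥0) ^ (m + l))⁻¹
  have hst : ∀ l, s ≤ t l := fun l => by
    have := Nat.le_ceil (s * 2 ^ (m + l))
    exact (le_mul_inv_iff₀ (by positivity)).2 this
  have hts : ∀ l, t l ≤ s + ((2 : ℝ≥0) ^ (m + l))⁻¹ := fun l => by
    have := (Nat.ceil_lt_add_one (a := s * 2 ^ (m + l)) zero_le).le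
    refine (mul_inv_le_iff₀ (by positivity)).2 (this.trans_eq ?_)
    field_simp
  have hlim : Tendsto t atTop (𝓝 s) := by
    refine tendsto_of_tendsto_of_tendsto_of_le_of_le tendsto_const_nhds ?_ hst hts
    have : Tendsto (fun l : ℕ => ((2 : ℝ≥0)⁻¹) ^ (l + m)) atTop (𝓝 0) :=
      (tendsto_add_atTop_iff_nat m).2
        (tendsto_pow_atTop_nhds_zero_of_lt_one zero_le (inv_lt_one_of_one_lt₀ one_lt_two))
    simpa [inv_pow, add_comm m] using this.const_add s
  refine ⟨t, tendsto_nhdsWithin_iff.2 ⟨hlim, Eventually.of_forall hst⟩, ?_⟩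
  have hend : s < (k + 1) * ((2 : ℝ≥0) ^ m)⁻¹ := (lt_mul_inv_iff₀ (by positivity)).2 hk2
  filter_upwards [hlim.eventually_lt_const hend] with l hl
  have h1 : k * 2 ^ l ≤ ⌈s * 2 ^ (m + l)⌉₊ := by
    have : (k : ℝ≥0) * 2 ^ l ≤ ⌈s * 2 ^ (m + l)⌉₊ :=
      (mul_le_mul_left hk1 (2 ^ l)).trans ((Nat.le_ceil _).trans' (by rw [pow_add, mul_assoc]))
    exact_mod_cast this
  have h2 : ⌈s * 2 ^ (m + l)⌉₊ < (k + 1) * 2 ^ l := by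
    have : (⌈s * 2 ^ (m + l)⌉₊ : ℝ≥0) < (k + 1) * 2 ^ l := by
      have := (mul_inv_lt_iff₀ (by positivity)).1 hl
      refine this.trans_eq ?_
      rw [pow_add]; field_simp
    exact_mod_cast this
  refine Set.mem_iUnion.2 ⟨l, ⌈s * 2 ^ (m + l)⌉₊ - k * 2 ^ l, ?_, ?_⟩
  · rw [add_mul, one_mul] at h2; omega
  · rw [Nat.add_sub_cancel' h1]

/-- Right-continuity lets countably many dyadic times control all the uncountably many times of the
interval. -/
lemma minOn_dyadicTimes_le {f : ℝ≥0 → ℤˣ} (hf : IsCadlag f) (m : ℕ) (s : ℝ≥0) :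
    minOn (dyadicTimes m ⌊s * 2 ^ m⌋₊) f ≤ f s := by
  refine le_of_eq_one_imp fun h => ?_
  obtain ⟨t, ht, hmem⟩ := exists_tendsto_mem_dyadicTimes m s
  have h1 : Tendsto (fun l => f (t l)) atTop (𝓝 (f s)) := (hf s).1.tendsto.comp ht
  rw [nhds_discrete, tendsto_pure] at h1
  obtain ⟨l, h2, h3⟩ := (h1.and hmem).exists
  rw [← h2]; exact minOn_eq_one.1 h _ h3

lemma le_measure_iInter {Ω : Type*} [MeasurableSpace Ω] {P : Measure Ω} [IsFiniteMeasure P]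
    {s : ℕ → Set Ω} (hm : ∀ l, MeasurableSet (s l)) (ha : Antitone s) {c : ℝ≥0∞}
    (hc : ∀ l, c ≤ P (s l)) : c ≤ P (⋂ l, s l) :=
  ge_of_tendsto' (tendsto_measure_iInter_atTop (fun l => (hm l).nullMeasurableSet) ha
    ⟨0, measure_ne_top _ _⟩) hc

/-! ### Reflection symmetry. -/

/-- The reflection of the lattice in the walk-time axis. -/
def reflect (z : EvenLattice) : EvenLattice :=
  ⟨(-z.1.1, z.1.2), by
    obtain ⟨k, hk⟩ := z.2
    exact ⟨k - z.1.1, by dsimp only; omega⟩⟩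

lemma reflect_injective : Function.Injective reflect := by
  intro z w h
  have h1 := congrArg (fun v : EvenLattice => v.1.1) h
  have h2 := congrArg (fun v : EvenLattice => v.1.2) h
  simp only [reflect] at h1 h2
  exact Subtype.ext (Prod.ext (neg_injective h1) h2)

lemma path_reflect (η : Arrows) (z : EvenLattice) (n : ℕ) :
    path (fun v => -η (reflect v)) z n = -path η (reflect z) n := by
  have h : Function.Semiconj reflect (step fun v => -η (reflect v)) (step η) := by
    intro v
    refine Subtype.ext (Prod.ext ?_ rfl)
    simp only [reflect, step, Units.val_neg]
    ring
  have h1 := (h.iterate_right n) z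
  rw [path, path, ← h1]
  simp [reflect]

/-! ### Simultaneous climbing over all dyadic intervals. -/

namespace IsDynamicalWeb

variable {Ω : Type*} [MeasurableSpace Ω] {P : Measure Ω} [IsProbabilityMeasure P] {lam : ℝ}
  {ξ : EvenLattice → ℝ≥0 → Ω → ℤˣ}

omit [IsProbabilityMeasure P] in
lemma ofReal_le_measure_dyadicPiece (hlam : 0 < lam) (hξ : IsDynamicalWeb P lam ξ) (m k l : ℕ)
    (z : EvenLattice) :
    ENNReal.ofReal (1 / 2 - lam / 2 ^ m / 4) ≤
      P {ω | minOn (dyadicPiece m k l) (fun s => ξ z s ω) = 1} := by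
  have h := hξ.ofReal_le_measure_low hlam z ((2 : ℝ≥0) ^ (m + l))⁻¹ (k * 2 ^ l) (2 ^ l - 1)
  rw [Nat.sub_add_cancel Nat.one_le_two_pow] at h
  refine le_trans (ENNReal.ofReal_le_ofReal ?_) h
  have h2 : ((2 ^ l - 1 : ℕ) : ℝ) ≤ 2 ^ l := by
    have : (2 ^ l - 1 : ℕ) ≤ 2 ^ l := Nat.sub_le _ _
    exact_mod_cast this
  have h3 : ((2 ^ l - 1 : ℕ) : ℝ) * (((2 : ℝ≥0) ^ (m + l))⁻¹ : ℝ≥0) ≤ (2 ^ m)⁻¹ := by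
    push_cast
    rw [mul_inv_le_iff₀ (by positivity), pow_add, inv_mul_cancel_left₀ (by positivity)]
    exact h2
  have h4 := mul_le_mul_of_nonneg_left h3 hlam.le
  rw [div_eq_mul_inv lam]
  linarith

lemma ofReal_le_measure_dyadicTimes (hlam : 0 < lam) (hξ : IsDynamicalWeb P lam ξ) (m k : ℕ)
    (z : EvenLattice) :
    ENNReal.ofReal (1 / 2 - lam / 2 ^ m / 4) ≤
      P {ω | minOn (dyadicTimes m k) (fun s => ξ z s ω) = 1} := by
  have e : {ω | minOn (dyadicTimes m k) (fun s => ξ z s ω) = 1} =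
      ⋂ l, {ω | minOn (dyadicPiece m k l) (fun s => ξ z s ω) = 1} := by
    ext ω
    simp only [Set.mem_ofPred_eq, Set.mem_iInter, minOn_eq_one, dyadicTimes, Set.mem_iUnion]
    exact ⟨fun h l s hs => h s ⟨l, hs⟩, fun h s ⟨l, hs⟩ => h l s hs⟩
  rw [e]
  refine le_measure_iInter
    (fun l => hξ.measurable_low (countable_dyadicPiece m k l) z (measurableSet_singleton 1))
    (fun l l' hl ω h => ?_) fun l => hξ.ofReal_le_measure_dyadicPiece hlam m k l z
  exact eq_one_of_le (minOn_anti (monotone_dyadicPiece m k hl) _) h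

/-- Harris' inequality is available at each finite dyadic level `l`. The events decrease in `l`, and
since `n` steps read finitely many arrows, their intersection is the event for all dyadic times. -/
lemma prod_climb_le (hlam : 0 < lam) (hξ : IsDynamicalWeb P lam ξ) (m M n : ℕ)
    (hm : lam / 2 ^ m ≤ 1 / 2) (x : ℤ) (z : Fin M → EvenLattice) :
    ENNReal.ofReal (∏ k, climb (1 / 2 - lam / 2 ^ m / 4) n (depth x (z k))) ≤
      P {ω | ∀ k : Fin M, Hits x (fun v => minOn (dyadicTimes m k) fun s => ξ v s ω) n (z k)} := by
  have hp : 0 < lam / 2 ^ m := by positivity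
  have e : {ω | ∀ k : Fin M, Hits x (fun v => minOn (dyadicTimes m k) fun s => ξ v s ω) n (z k)} =
      ⋂ l, {ω | ∀ k : Fin M, Hits x (fun v => minOn (dyadicPiece m k l) fun s => ξ v s ω) n (z k)} := by
    ext ω
    simp only [Set.mem_ofPred_eq, Set.mem_iInter]
    refine ⟨fun h l k => (h k).of_le (fun v => ?_) rfl le_rfl, fun h k => ?_⟩
    · exact minOn_anti (Set.subset_iUnion _ l) _
    · obtain ⟨V, hV⟩ := exists_finset_stopped_congr x n (z k)
      obtain ⟨l, hl⟩ := ((Filter.eventually_all_finset V).2 fun v _ =>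
        eventually_minOn_eq (monotone_dyadicPiece m k) fun s => ξ v s ω).exists
      have := h l k
      rw [Hits, hV _ _ hl] at this
      exact this
  rw [e]
  refine le_measure_iInter (fun l => ?_) ?_ fun l => ?_
  · simp only [Set.ofPred_forall]
    exact MeasurableSet.iInter fun k => measurableSet_hits x n _ fun v _ _ =>
      hξ.measurable_low (countable_dyadicPiece m k l) v
  · intro l l' hl ω h k
    exact (h k).of_le (fun v => minOn_anti (monotone_dyadicPiece m k hl) _) rfl le_rfl
  · have h1 := hξ.prod_measureReal_hits_le hlam ((2 : ℝ≥0) ^ (m + l))⁻¹ (M * 2 ^ l) Finset.univ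
      (fun k : Fin M => dyadicPiece m k l) (by
        rintro k - s ⟨i, hi, rfl⟩
        refine ⟨⟨k * 2 ^ l + i, ?_⟩, rfl⟩
        have : (k + 1 : ℕ) * 2 ^ l ≤ M * 2 ^ l := Nat.mul_le_mul_right _ k.2
        rw [add_mul, one_mul] at this
        omega) x n z
    simp only [Finset.mem_univ, true_imp_iff] at h1
    rw [← ENNReal.ofReal_toReal (measure_ne_top P _)]
    refine ENNReal.ofReal_le_ofReal (le_trans (Finset.prod_le_prod (fun k _ => ?_) fun k _ => ?_) h1)
    · exact (climb_mem_Icc (by linarith) (by linarith) _ _).1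
    · rw [measureReal_def, ← ENNReal.ofReal_le_iff_le_toReal (measure_ne_top _ _)]
      exact ofReal_climb_le_measure_hits
        (fun v => hξ.measurable_low (countable_dyadicPiece m k l) v)
        (hξ.iIndepFun_low (countable_dyadicPiece m k l)) (by linarith) (by linarith)
        (fun v => hξ.ofReal_le_measure_dyadicPiece hlam m k l v) x n (z k)

/-- Lower bound for the probability that, for all the dynamical time intervals of length
`1 / 2 ^ m`, the lowest path over the interval climbs to `x`. -/
lemma exp_le_measure_hits (hlam : 0 < lam) (hξ : IsDynamicalWeb P lam ξ) (m M : ℕ)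
    (hm : lam / 2 ^ m ≤ 1 / 2) (x : ℤ) (z : Fin M → EvenLattice) {C : ℝ}
    (hC : (∑ k, (depth x (z k) : ℝ)) / 2 ^ m ≤ C) :
    Real.exp (-(2 * lam * C)) ≤
      P.real {ω | ∀ k : Fin M, ∃ n, Hits x (fun v => minOn (dyadicTimes m k) fun s => ξ v s ω) n (z k)} := by
  have hp : 0 < lam / 2 ^ m := by positivity
  set q := 1 / 2 - lam / 2 ^ m / 4 with hq
  have hq0 : 0 < q := by linarith
  choose l hl hle using fun k => exists_climb_tendsto hq0 (by linarith) (depth x (z k))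
  have hr : Real.exp (-(2 * (lam / 2 ^ m))) ≤ q / (1 - q) := by
    -- With `p = lam / 2 ^ m`, the ratio is `(2 - p) / (2 + p) ≥ 1 - p`, and `(1 - p) * (1 + 2 * p)
    -- ≥ 1` because `p ≤ 1 / 2`.
    have h1 : 1 - lam / 2 ^ m ≤ q / (1 - q) := by
      rw [le_div_iff₀ (by linarith), hq]
      nlinarith
    refine le_trans ?_ h1
    have h2 := Real.add_one_le_exp (2 * (lam / 2 ^ m))
    rw [Real.exp_neg]
    refine inv_le_of_inv_le₀ (by linarith) (le_trans ?_ h2)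
    rw [inv_le_iff_one_le_mul₀ (by linarith)]
    nlinarith
  have hlim := tendsto_finsetProd Finset.univ fun k _ => hl k
  have h3 : ∏ k, l k ≤ P.real {ω | ∀ k : Fin M, ∃ n,
      Hits x (fun v => minOn (dyadicTimes m k) fun s => ξ v s ω) n (z k)} := by
    refine le_of_tendsto' hlim fun n => ?_
    rw [measureReal_def, ← ENNReal.ofReal_le_iff_le_toReal (measure_ne_top _ _)]
    refine (hξ.prod_climb_le hlam m M n hm x z).trans (measure_mono fun ω h k => ⟨n, h k⟩)
  refine le_trans ?_ h3
  calc Real.exp (-(2 * lam * C))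
      ≤ Real.exp (-(2 * lam * ((∑ k, (depth x (z k) : ℝ)) / 2 ^ m))) := by
        gcongr
    _ = ∏ k, Real.exp (-(2 * (lam / 2 ^ m))) ^ depth x (z k) := by
        rw [Finset.prod_pow_eq_pow_sum, ← Real.exp_nat_mul]
        congr 1
        push_cast
        ring
    _ ≤ ∏ k, l k := by
        refine Finset.prod_le_prod (fun k _ => by positivity) fun k _ => le_trans ?_ (hle k)
        gcongr

/-! ### Conditioning on the first steps and Lévy's zero-one law. -/

/-- The sigma-algebra of the arrows at lattice points in `A`, at all dynamical times. -/
@[reducible]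
def sigmaOf (ξ : EvenLattice → ℝ≥0 → Ω → ℤˣ) (A : Set EvenLattice) : MeasurableSpace Ω :=
  ⨆ v ∈ A, MeasurableSpace.comap (fun ω s => ξ v s ω) inferInstance

omit [IsProbabilityMeasure P] in
lemma sigmaOf_le (hξ : IsDynamicalWeb P lam ξ) (A : Set EvenLattice) :
    sigmaOf ξ A ≤ ‹MeasurableSpace Ω› :=
  iSup₂_le fun v _ => (hξ.measurable_fun v).comap_le

omit [MeasurableSpace Ω] in
lemma measurable_sigmaOf_low {A : Set EvenLattice} {v : EvenLattice} (hv : v ∈ A) {S : Set ℝ≥0}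
    (hS : S.Countable) : Measurable[sigmaOf ξ A] fun ω => minOn S fun s => ξ v s ω :=
  (measurable_minOn hS).comp <| Measurable.mono (comap_measurable fun (ω : Ω) (s : ℝ≥0) => ξ v s ω)
    (le_biSup (fun v => MeasurableSpace.comap (fun (ω : Ω) (s : ℝ≥0) => ξ v s ω) inferInstance) hv)
    le_rfl

/-- The filtration of the arrows over walk times before `j + n`. -/
def arrowFiltration (hξ : IsDynamicalWeb P lam ξ) (j : ℤ) :
    Filtration ℕ ‹MeasurableSpace Ω› where
  seq n := sigmaOf ξ {v | v.1.2 < j + n}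
  mono' n n' h := biSup_mono fun v (hv : v.1.2 < j + n) => show v.1.2 < j + n' by omega
  le' n := hξ.sigmaOf_le _

/-- The event that for some `m` the lowest paths over all dyadic intervals of length `1 / 2 ^ m`
in `[0, T)` reach `x`. -/
def lowHits (ξ : EvenLattice → ℝ≥0 → Ω → ℤˣ) (x : ℤ) (z : EvenLattice) (T : ℕ) : Set Ω :=
  {ω | ∃ m, ∀ k : Fin (T * 2 ^ m), ∃ n,
    Hits x (fun v => minOn (dyadicTimes m k) fun s => ξ v s ω) n z}

omit [IsProbabilityMeasure P] in
lemma measurableSet_lowHits (hξ : IsDynamicalWeb P lam ξ) (x : ℤ) (z : EvenLattice) (T : ℕ) :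
    MeasurableSet[⨆ n, hξ.arrowFiltration z.1.2 n] (lowHits ξ x z T) := by
  unfold lowHits
  simp only [Set.ofPred_exists, Set.ofPred_forall]
  refine MeasurableSet.iUnion fun m => MeasurableSet.iInter fun k => MeasurableSet.iUnion fun n => ?_
  refine (le_iSup (fun n => (hξ.arrowFiltration z.1.2 n : MeasurableSpace Ω)) n) _ ?_
  exact measurableSet_hits x n z fun v _ h => measurable_sigmaOf_low h (countable_dyadicTimes m k)

lemma exp_le_condExp (hlam : 0 < lam) (hξ : IsDynamicalWeb P lam ξ) (m n T : ℕ)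
    (hm : lam / 2 ^ m ≤ 1 / 2) (x : ℤ) (z : EvenLattice) (C : ℝ) :
    ∀ᵐ ω ∂P, (∑ k : Fin (T * 2 ^ m), (depth x (stopped x
        (fun v => minOn (dyadicTimes m k) fun s => ξ v s ω) n z) : ℝ)) / 2 ^ m ≤ C →
      Real.exp (-(2 * lam * C)) ≤
        (P[(lowHits ξ x z T).indicator (fun _ => (1 : ℝ)) | hξ.arrowFiltration z.1.2 n]) ω := by
  set ζ : Fin (T * 2 ^ m) → EvenLattice → Ω → ℤˣ :=
    fun k v ω => minOn (dyadicTimes m k) fun s => ξ v s ω with hζ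
  have hD : MeasurableSet (lowHits ξ x z T) :=
    (iSup_le fun n => (hξ.arrowFiltration z.1.2).le n) _ (hξ.measurableSet_lowHits x z T)
  -- The positions after `n` steps take countably many values `φ`. For fixed `φ` the continuation is
  -- an event of the arrows from walk time `z.1.2 + n` on, hence independent of the past; frozen
  -- paths contribute the sure event.
  have key : ∀ φ : Fin (T * 2 ^ m) → EvenLattice, ∀ᵐ ω ∂P,
      (∀ k, stopped x (fun v => ζ k v ω) n z = φ k) →
      (∀ k, x ≤ (φ k).1.1 ∨ (φ k).1.2 = z.1.2 + n) →
      P.real {ω | ∀ k, ∃ N, Hits x (fun v => ζ k v ω) N (φ k)} ≤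
        (P[(lowHits ξ x z T).indicator (fun _ => (1 : ℝ)) | hξ.arrowFiltration z.1.2 n]) ω := by
    intro φ
    by_cases hφ : ∀ k, x ≤ (φ k).1.1 ∨ (φ k).1.2 = z.1.2 + n
    swap
    · exact Eventually.of_forall fun ω _ h => absurd h hφ
    set B : Set Ω := {ω | ∀ k, stopped x (fun v => ζ k v ω) n z = φ k} with hB
    set E : Set Ω := {ω | ∀ k, ∃ N, Hits x (fun v => ζ k v ω) N (φ k)} with hE
    have hBm : MeasurableSet[hξ.arrowFiltration z.1.2 n] B := by
      rw [hB]; simp only [Set.ofPred_forall]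
      refine MeasurableSet.iInter fun k => ?_
      exact measurable_stopped x n z (fun v _ h => measurable_sigmaOf_low h
        (countable_dyadicTimes m k)) (measurableSet_singleton (φ k))
    have hEm : MeasurableSet[sigmaOf ξ {v | z.1.2 + n ≤ v.1.2}] E := by
      rw [hE]; simp only [Set.ofPred_forall, Set.ofPred_exists]
      refine MeasurableSet.iInter fun k => MeasurableSet.iUnion fun N => ?_
      rcases hφ k with h | h
      · convert MeasurableSet.univ
        refine Set.eq_univ_of_forall fun ω => ?_
        rw [Set.mem_ofPred_eq, Hits, stopped_of_le _ _ h]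
        exact h
      · exact measurableSet_hits x N _ fun v h1 _ => measurable_sigmaOf_low (h ▸ h1)
          (countable_dyadicTimes m k)
    have hEm' := hξ.sigmaOf_le _ _ hEm
    have hind : Indep (sigmaOf ξ {v | z.1.2 + n ≤ v.1.2}) (hξ.arrowFiltration z.1.2 n) P :=
      indep_iSup_of_disjoint (fun v => (hξ.measurable_fun v).comap_le)
        ((iIndepFun_iff_iIndep _ _ _).1 hξ.indep)
        (Set.disjoint_left.2 fun v (h1 : z.1.2 + n ≤ v.1.2) (h2 : v.1.2 < z.1.2 + n) =>
          absurd h1 (not_le.2 h2))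
    have hEint : Integrable (E.indicator fun _ => (1 : ℝ)) P :=
      (integrable_const 1).indicator hEm'
    have h1 := condExp_indep_eq (μ := P) (f := E.indicator fun _ => (1 : ℝ)) (hξ.sigmaOf_le _)
      ((hξ.arrowFiltration z.1.2).le n)
      (StronglyMeasurable.indicator (@stronglyMeasurable_const _ _ (_) _ _) hEm) hind
    have h2 := condExp_indicator (m := hξ.arrowFiltration z.1.2 n) hEint hBm
    have h3 := condExp_mono (m := hξ.arrowFiltration z.1.2 n) (μ := P)
      (hEint.indicator ((hξ.arrowFiltration z.1.2).le n _ hBm))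
      ((integrable_const (1 : ℝ)).indicator hD) (Eventually.of_forall fun ω => by
        change B.indicator (E.indicator fun _ => (1 : ℝ)) ω ≤
          (lowHits ξ x z T).indicator (fun _ => (1 : ℝ)) ω
        by_cases hω : ω ∈ B ∩ E
        · have : ω ∈ lowHits ξ x z T := ⟨m, fun k => by
            obtain ⟨N, hN⟩ := hω.2 k
            refine ⟨n + N, ?_⟩
            rw [Hits, stopped_add, show stopped x _ n z = φ k from hω.1 k]
            exact hN⟩
          simp [hω.1, hω.2, this]
        · rw [Set.indicator_indicator, Set.indicator_of_notMem hω]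
          exact Set.indicator_nonneg (fun _ _ => zero_le_one) _)
    filter_upwards [h1, h2, h3] with ω h1 h2 h3 hω _
    rw [h2, Set.indicator_of_mem (show ω ∈ B from hω), h1, integral_indicator_const _ hEm',
      smul_eq_mul, mul_one] at h3
    exact h3
  filter_upwards [ae_all_iff.2 key] with ω hω hC
  refine (hξ.exp_le_measure_hits hlam m _ hm x _ hC).trans (hω _ (fun k => rfl) fun k => ?_)
  by_cases h : Hits x (fun v => ζ k v ω) n z
  · exact Or.inl h
  · exact Or.inr (stopped_snd_eq h)

/-- The scale `m` must grow with `n` here, whereas Lévy's law needs one fixed event; this is why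
`lowHits` allows any `m`. -/
lemma ae_lowHits (hlam : 0 < lam) (hξ : IsDynamicalWeb P lam ξ) (x : ℤ) (z : EvenLattice) (T : ℕ) :
    ∀ᵐ ω ∂P, ω ∈ lowHits ξ x z T := by
  -- This scale makes the drift accumulated over `n` steps less than `1`, and also secures `lam / 2
  -- ^ m ≤ 1 / 2`.
  have hex : ∀ n : ℕ, ∃ m : ℕ, 2 * lam * (n + 1) ≤ 2 ^ m := fun n =>
    (pow_unbounded_of_one_lt (2 * lam * (n + 1)) one_lt_two).imp fun _ h => h.le
  choose m hm using hex
  have hm1 : ∀ n, lam / 2 ^ m n * (n + 1) ≤ 1 / 2 := fun n => by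
    rw [div_mul_eq_mul_div, div_le_iff₀ (by positivity)]; linarith [hm n]
  have hm2 : ∀ n, lam / 2 ^ m n ≤ 1 / 2 := fun n => (hm1 n).trans' <|
    le_mul_of_one_le_right (by positivity) (by linarith [n.cast_nonneg (α := ℝ)])
  let Z (n : ℕ) (k : ℕ) (ω : Ω) : EvenLattice :=
    stopped x (fun v => minOn (dyadicTimes (m n) k) fun s => ξ v s ω) n z
  have hZ : ∀ n k, Measurable (Z n k) := fun n k => measurable_stopped x n z fun v _ _ =>
    hξ.measurable_low (countable_dyadicTimes (m n) k) v
  let U (n : ℕ) (ω : Ω) : ℝ≥0∞ :=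
    (∑ k : Fin (T * 2 ^ m n), (depth x (Z n k ω) : ℝ≥0∞)) * (2 ^ m n)⁻¹
  have hSm : ∀ n, ∀ k : Fin (T * 2 ^ m n), Measurable fun ω => (depth x (Z n k ω) : ℝ≥0∞) :=
    fun n k => (measurable_of_countable fun v => (depth x v : ℝ≥0∞)).comp (hZ n k)
  have hUm : ∀ n, Measurable (U n) := fun n =>
    (Finset.measurable_fun_sum _ fun k _ => hSm n k).mul_const _
  have hUle : ∀ n, ∫⁻ ω, U n ω ∂P ≤ T * ENNReal.ofReal (depth x z + 1) := by
    intro n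
    simp only [U]
    rw [lintegral_mul_const _ (Finset.measurable_fun_sum _ fun k _ => hSm n k),
      lintegral_finsetSum _ fun k _ => hSm n k]
    have h1 : ∀ k : Fin (T * 2 ^ m n), ∫⁻ ω, (depth x (Z n k ω) : ℝ≥0∞) ∂P ≤
        ENNReal.ofReal (depth x z + 1) := fun k => by
      have hp : 0 < lam / 2 ^ m n := by positivity
      refine (lintegral_depth_stopped_le
        (fun v => hξ.measurable_low (countable_dyadicTimes (m n) k) v)
        (hξ.iIndepFun_low (countable_dyadicTimes (m n) k))
        (q := 1 / 2 - lam / 2 ^ m n / 4) (by linarith)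
        (fun v => hξ.ofReal_le_measure_dyadicTimes hlam (m n) k v) x n z).trans ?_
      refine ENNReal.ofReal_le_ofReal ?_
      have := hm1 n
      nlinarith
    refine (mul_le_mul_left (Finset.sum_le_sum fun k _ => h1 k) _).trans_eq ?_
    rw [Finset.sum_const, Finset.card_univ, Fintype.card_fin, nsmul_eq_mul]
    push_cast
    rw [mul_right_comm, mul_assoc (T : ℝ≥0∞), ENNReal.mul_inv_cancel (by simp) (by simp), mul_one]
  -- Fatou's lemma with the uniform bound `hUle` on the means.
  have hfat : ∀ᵐ ω ∂P, liminf (fun n => U n ω) atTop < ∞ := by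
    refine ae_lt_top (Measurable.liminf hUm) (ne_top_of_le_ne_top ?_ ((lintegral_liminf_le hUm).trans
      (liminf_le_of_le (by isBoundedDefault) fun b hb => ?_)) (b := T * ENNReal.ofReal (depth x z + 1)))
    · exact ENNReal.mul_ne_top (ENNReal.natCast_ne_top T) ENNReal.ofReal_ne_top
    · obtain ⟨n, hn⟩ := hb.exists
      exact hn.trans (hUle n)
  have hlev := tendsto_ae_condExp (μ := P) (ℱ := hξ.arrowFiltration z.1.2)
    ((lowHits ξ x z T).indicator fun _ => (1 : ℝ))
  have hsup : (⨆ n, (hξ.arrowFiltration z.1.2 n : MeasurableSpace Ω)) ≤ ‹MeasurableSpace Ω› :=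
    iSup_le fun n => (hξ.arrowFiltration z.1.2).le n
  have hD := hξ.measurableSet_lowHits x z T
  rw [condExp_of_stronglyMeasurable hsup
    (StronglyMeasurable.indicator (@stronglyMeasurable_const _ _ (_) _ _) hD)
    ((integrable_const 1).indicator (hsup _ hD))] at hlev
  filter_upwards [hfat, hlev, ae_all_iff.2 fun n => ae_all_iff.2 fun C : ℕ =>
    hξ.exp_le_condExp hlam (m n) n T (hm2 n) x z C] with ω hfin hlim hexp
  -- Off `lowHits` the conditional probabilities tend to `0`, yet they are at least `exp (-(2 * lam
  -- * C))` whenever `U n ω < C`, which happens infinitely often.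
  by_contra hω
  rw [Set.indicator_of_notMem hω] at hlim
  obtain ⟨C, hC⟩ := ENNReal.exists_nat_gt hfin.ne
  have hfreq := frequently_lt_of_liminf_lt (by isBoundedDefault) hC
  obtain ⟨n, hn, hlt⟩ := (hfreq.and_eventually
    (hlim.eventually_lt_const (Real.exp_pos (-(2 * lam * C))))).exists
  refine absurd (hexp n C ?_) (not_le.2 hlt)
  have := (ENNReal.toReal_le_toReal hn.ne_top (by simp)).2 hn.le
  simp only [U, ENNReal.toReal_mul, ENNReal.toReal_inv, ENNReal.toReal_pow, ENNReal.toReal_natCast,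
    ENNReal.toReal_ofNat] at this
  rw [ENNReal.toReal_sum fun k _ => ENNReal.natCast_ne_top _] at this
  rw [div_eq_mul_inv]
  simpa using this

/-! ### From lowest paths to all dynamical times. -/

lemma ae_exists_path_eq_of_le (hlam : 0 < lam) (hξ : IsDynamicalWeb P lam ξ) {x : ℤ}
    {z : EvenLattice} (hz : z.1.1 ≤ x) :
    ∀ᵐ ω ∂P, ∀ s : ℝ≥0, ∃ n, path (fun v => ξ v s ω) z n = x := by
  filter_upwards [ae_all_iff.2 fun T => hξ.ae_lowHits hlam x z T, ae_all_iff.2 hξ.cadlag]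
    with ω hω hc s
  obtain ⟨T, hT⟩ := exists_nat_gt s
  obtain ⟨m, hm⟩ := hω T
  have hk : ⌊s * 2 ^ m⌋₊ < T * 2 ^ m := by
    rw [Nat.floor_lt zero_le]
    push_cast
    gcongr
  obtain ⟨n, hn⟩ := hm ⟨_, hk⟩
  exact (hn.of_le (η' := fun v => ξ v s ω) (fun v => minOn_dyadicTimes_le (hc v) m s) rfl
    le_rfl).exists_path_eq hz

omit [IsProbabilityMeasure P] in
lemma neg_reflect (hξ : IsDynamicalWeb P lam ξ) :
    IsDynamicalWeb P lam fun z s ω => -ξ (reflect z) s ω where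
  measurable z s := (measurable_of_countable fun e : ℤˣ => -e).comp (hξ.measurable (reflect z) s)
  cadlag z := by
    filter_upwards [hξ.cadlag (reflect z)] with ω h s
    have hc : Continuous fun e : ℤˣ => -e := continuous_of_discreteTopology
    obtain ⟨h1, l, h2⟩ := h s
    exact ⟨hc.continuousAt.comp_continuousWithinAt h1, -l, (hc.tendsto l).comp h2⟩
  markov z n s x hs h0 := by
    have := hξ.markov (reflect z) n s (fun k => -x k) hs h0
    simp only [transition, neg_inj] at this
    simp only [transition, neg_eq_iff_eq_neg, this]
  indep := (hξ.indep.precomp reflect_injective).comp (fun _ f s => -f s) fun _ =>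
    measurable_pi_lambda _ fun s =>
      (measurable_of_countable fun e : ℤˣ => -e).comp (measurable_pi_apply s)

lemma ae_exists_path_eq (hlam : 0 < lam) (hξ : IsDynamicalWeb P lam ξ) (x : ℤ) (z : EvenLattice) :
    ∀ᵐ ω ∂P, ∀ s : ℝ≥0, ∃ n, path (fun v => ξ v s ω) z n = x := by
  rcases le_total z.1.1 x with hz | hz
  · exact hξ.ae_exists_path_eq_of_le hlam hz
  · filter_upwards [hξ.neg_reflect.ae_exists_path_eq_of_le hlam (z := reflect z) (x := -x)
      (neg_le_neg hz)] with ω h s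
    obtain ⟨n, hn⟩ := h s
    refine ⟨n, ?_⟩
    rw [path_reflect (fun v => ξ v s ω), neg_inj] at hn
    have : reflect (reflect z) = z := Subtype.ext (Prod.ext (neg_neg _) rfl)
    rwa [this] at hn

end IsDynamicalWeb

end DynamicalDiscreteWeb

theorem theorem1 {Ω : Type*} [MeasurableSpace Ω] (P : Measure Ω) [IsProbabilityMeasure P]
    (lam : ℝ) (hlam : 0 < lam)
    (ξ : DynamicalDiscreteWeb.EvenLattice → ℝ≥0 → Ω → ℤˣ)
    (hξ : DynamicalDiscreteWeb.IsDynamicalWeb P lam ξ) :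
    ∀ᵐ ω ∂P, ∀ (s : ℝ≥0) (z : DynamicalDiscreteWeb.EvenLattice),
      DynamicalDiscreteWeb.IsRecurrent (DynamicalDiscreteWeb.path (fun z' => ξ z' s ω) z) := by

  filter_upwards [ae_all_iff.2 fun x => ae_all_iff.2 fun z => hξ.ae_exists_path_eq hlam x z]
    with ω h s z x
  refine frequently_atTop.2 fun N => ?_
  -- The exceptional null set serves all starting points, so the random position after `N` steps is
  -- allowed as a new start.
  obtain ⟨n, hn⟩ := h x ((DynamicalDiscreteWeb.step fun v => ξ v s ω)^[N] z) s
  refine ⟨n + N, Nat.le_add_left N n, ?_⟩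
  rw [DynamicalDiscreteWeb.path, Function.iterate_add_apply]
  exact hn
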